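/- Let $\theta_R>0$, $\theta\in[0,\theta_R]$, $\omega\in(0,2\pi/\theta_R]$, $P_T>0$ and $\sigma_v\ge 0$. Let $\eta_1,\eta_2,\dots$ be i.i.d. real random variables with an arbitrary common distribution that is symmetric about $0$, and let $\varphi_\eta(t)=\mathrm{E}[e^{jt\eta_1}]$ be its characteristic function, which is real-valued. Let the channel noise $v\sim\mathcal{CN}(0,\sigma_v^2)$ be circularly symmetric complex Gaussian with $\mathrm{E}|v|^2=\sigma_v^2$ and independent of $(\eta_i)$. For $L$ sensors with measurements $x_i=\theta+\eta_i$ and fixed total power $P_T$ put $$y_L=\sqrt{\tfrac{P_T}{L}}\sum_{i=1}^{L}e^{j\omega x_i}+v,\qquad z_L=\frac{y_L}{\sqrt L},\qquad \hat\theta=\frac1\omega\tan^{-1}\!\left(\frac{\operatorname{Im}z_L}{\operatorname{Re}z_L}\right),$$ where $\tan^{-1}$ is one of the following: (a) the principal value in $(-\pi/2,\pi/2)$, in which case it is assumed that $\varphi_\eta(\omega)\neq0$ and $\omega\theta<\pi/2$; (b) the quadrant-aware inverse tangent, that is, the phase of $z_L$ in $[0,2\pi)$, in which case it is assumed that $\varphi_\eta(\omega)>0$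 and $0<\omega\theta<2\pi$. In both cases $\sqrt L\,(\hat\theta-\theta)$ converges in distribution, as $L\to\infty$, to a normal law with mean zero and variance $$AsV(\omega)=\frac{\dfrac{\sigma_v^2}{P_T}+1-\varphi_\eta(2\omega)}{2\,\omega^2\,\varphi_\eta^2(\omega)}\ \ge 0,$$ where a normal law of variance $0$ is the point mass at $0$. -/

import Mathlib

open MeasureTheory ProbabilityTheory Filter Complex

noncomputable section

/-- The circularly symmetric complex Gaussian law `CN(0, s)` with total variance `E|v|² = s`:
real and imaginary parts are independent real Gaussians `N(0, s / 2)`. -/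
def complexGaussian (s : ℝ) : Measure ℂ :=
  ((gaussianReal 0 (s / 2).toNNReal).prod (gaussianReal 0 (s / 2).toNNReal)).map
    (fun p : ℝ × ℝ => (p.1 : ℂ) + (p.2 : ℂ) * I)

/-- A law on the real line is symmetric about zero. -/
def IsSymmetricLaw (μ : Measure ℝ) : Prop :=
  μ.map (fun x => -x) = μ

/-- The characteristic function `t ↦ E[exp(i t η)]` of a symmetric law `μ` of `η`, as a real-valued
function (for symmetric laws nothing is lost, see `ofReal_realCharFun`). -/
def realCharFun (μ : Measure ℝ) (t : ℝ) : ℝ :=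
  (charFun μ t).re

/-- The characteristic function of a symmetric law is real-valued. -/
theorem ofReal_realCharFun {μ : Measure ℝ} (hμ : IsSymmetricLaw μ) (t : ℝ) :
    ((realCharFun μ t : ℝ) : ℂ) = charFun μ t := by
  have h : charFun μ (-t) = charFun μ t := by
    have h2 : charFun (μ.map (fun x => -x)) t = charFun μ (-t) := by
      have h3 := charFun_map_mul (μ := μ) (-1) t
      simpa using h3
    rw [← h2, hμ]
  rw [charFun_neg] at h
  exact Complex.conj_eq_iff_re.mp h

variable {Ω : Type*}

/-- The measurement `x_i = θ + η_i` of sensor `i`. -/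
def measurement (θ : ℝ) (η : ℕ → Ω → ℝ) (i : ℕ) (w : Ω) : ℝ :=
  θ + η i w

/-- The received signal `y_L = √ρ ∑ exp(j ω x_i) + v` for `L` sensors, with per-sensor power
`ρ = P_T / L` coming from the total power `P_T`. Sensors are numbered from `0`. -/
def receivedSignal (PT ω θ : ℝ) (η : ℕ → Ω → ℝ) (v : Ω → ℂ) (L : ℕ) (w : Ω) : ℂ :=
  (Real.sqrt (PT / L) : ℂ) *
    ∑ i ∈ Finset.range L, Complex.exp (I * ((ω * measurement θ η i w : ℝ) : ℂ)) + v w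

/-- The normalized received signal `z_L = y_L / √L`. -/
def normalizedSignal (PT ω θ : ℝ) (η : ℕ → Ω → ℝ) (v : Ω → ℂ) (L : ℕ) (w : Ω) : ℂ :=
  receivedSignal PT ω θ η v L w / (Real.sqrt L : ℂ)

/-- The phase of a complex number, normalized to lie in `[0, 2π)`. -/
def phase (z : ℂ) : ℝ :=
  toIcoMod Real.two_pi_pos 0 (Complex.arg z)

/-- The estimate `(1 / ω) arctan (z^I / z^R)` with the principal value of the inverse tangent. -/
def arctanEstimate (ω : ℝ) (z : ℂ) : ℝ :=
  1 / ω * Real.arctan (z.im / z.re)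

/-- The estimate `(1 / ω) tan⁻¹ (z^I / z^R)` where the inverse tangent takes the signs of `z^I` and
`z^R` into account, i.e. it is the phase of `z` in `[0, 2π)`. -/
def phaseEstimate (ω : ℝ) (z : ℂ) : ℝ :=
  1 / ω * phase z

/-- The asymptotic variance of the estimator; `σv ^ 2` is the variance of the channel noise and
`μ` is the law of the sensing noise. -/
def AsV (μ : Measure ℝ) (PT σv ω : ℝ) : ℝ :=
  (σv ^ 2 / PT + 1 - realCharFun μ (2 * ω)) / (2 * ω ^ 2 * realCharFun μ ω ^ 2)

/-- The sequence `X` converges in distribution to a normal law with mean `m` and variance `s`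
(with `s ≥ 0`, the normal law being the Dirac mass at `m` if `s = 0`). -/
def AsymptoticallyNormal [MeasurableSpace Ω] (P : Measure Ω) [IsProbabilityMeasure P]
    (X : ℕ → Ω → ℝ) (m s : ℝ) : Prop :=
  0 ≤ s ∧ TendstoInDistribution X atTop (id : ℝ → ℝ) (fun _ => P) (gaussianReal m s.toNNReal)

end

open scoped Topology

/-! Factoring out the true phase gives `z_L = √PT * exp(jωθ) * (A_L + j * T_L / √L)`. Here `A_L` is
the mean of `cos (ω η_i)` plus a noise term of order `1 / √L`, so it tends a.s. to `φ(ω)` by the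
strong law. `T_L` is the normalized sum of `sin (ω η_i)`, centered by symmetry, plus one quadrature
of the noise. By the central limit theorem and independence `T_L` tends to a normal law of variance
`(1 - φ(2ω)) / 2 + σv² / (2 PT)`. Almost surely, for large `L`, the estimation error is exactly
`arctan (T_L / (√L A_L)) / ω`, since the phase `ωθ` is interior to the range of the inverse tangent.
The delta method then divides the variance by `(ω φ(ω))²`. The two estimators differ only in how
they invert the polar form, which `asymptoticallyNormal_of_polar` takes as a hypothesis. -/

lemma complexGaussian_map_re_im (s c d : ℝ) :
    (complexGaussian s).map (fun z => c * z.re + d * z.im) =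
      gaussianReal 0 ((c ^ 2 + d ^ 2) * (s / 2)).toNNReal := by
  have h1 : (complexGaussian s).map (fun z => c * z.re + d * z.im) =
      ((gaussianReal 0 (s / 2).toNNReal).map (fun x => c * x)) ∗
        ((gaussianReal 0 (s / 2).toNNReal).map (fun x => d * x)) := by
    rw [complexGaussian, Measure.conv, Measure.map_prod_map _ _ (by fun_prop) (by fun_prop),
      Measure.map_map (by fun_prop) (by fun_prop), Measure.map_map (by fun_prop) (by fun_prop)]
    congr 1
    ext p
    simp
  rw [h1, gaussianReal_map_const_mul, gaussianReal_map_const_mul, gaussianReal_conv_gaussianReal]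
  congr 1
  · simp
  · ext
    rcases le_total 0 (s / 2) with h | h
    · have : 0 ≤ (c ^ 2 + d ^ 2) * (s / 2) := by positivity
      simp [Real.coe_toNNReal _ h, Real.coe_toNNReal _ this]
      ring
    · have : (c ^ 2 + d ^ 2) * (s / 2) ≤ 0 := mul_nonpos_of_nonneg_of_nonpos (by positivity) h
      simp [Real.toNNReal_of_nonpos h, Real.toNNReal_of_nonpos this]

/-- Adding an independent centered Gaussian variable to a sequence converging in distribution to a
centered normal law. -/
lemma tendstoInDistribution_add_gaussian {Ω : Type*} [MeasurableSpace Ω] {P : Measure Ω}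
    [IsProbabilityMeasure P] {S : ℕ → Ω → ℝ} {W : Ω → ℝ} {a b : NNReal}
    (hS : TendstoInDistribution S atTop (id : ℝ → ℝ) (fun _ => P) (gaussianReal 0 a))
    (hW : HasLaw W (gaussianReal 0 b) P) (hSW : ∀ n, IndepFun (S n) W P) :
    TendstoInDistribution (fun n w => S n w + W w) atTop (id : ℝ → ℝ) (fun _ => P)
      (gaussianReal 0 (a + b)) where
  forall_aemeasurable n := (hS.forall_aemeasurable n).add hW.aemeasurable
  tendsto := by
    -- Lévy's continuity theorem: by independence the characteristic function of `W`, the same for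
    -- all `n`, is just a fixed factor.
    refine ProbabilityMeasure.tendsto_iff_tendsto_charFun.2 fun t ↦ ?_
    have h := ProbabilityMeasure.tendsto_iff_tendsto_charFun.1 hS.tendsto t
    simp only [ProbabilityMeasure.coe_mk, Measure.map_id, charFun_gaussianReal] at h ⊢
    have h2 := h.mul_const (charFun (P.map W) t)
    rw [hW.map_eq, charFun_gaussianReal, ← Complex.exp_add] at h2
    refine (h2.congr fun n => ?_).trans_eq ?_
    · rw [(hSW n).charFun_map_fun_add_eq_mul (hS.forall_aemeasurable n) hW.aemeasurable,
        Pi.mul_apply, hW.map_eq, charFun_gaussianReal]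
    · congr 2
      push_cast
      ring

/-! ### Trigonometric moments of a symmetric law -/

section SymmetricLaw

variable {μ : Measure ℝ}

lemma integral_cos_eq_realCharFun [IsProbabilityMeasure μ] (t : ℝ) :
    ∫ x, Real.cos (t * x) ∂μ = realCharFun μ t := by
  have hi : Integrable (fun x : ℝ => cexp (t * x * I)) μ := by
    refine Integrable.of_bound (by fun_prop) 1 (ae_of_all _ fun x => ?_)
    rw [← ofReal_mul, norm_exp_ofReal_mul_I]
  have h := integral_re hi
  rw [realCharFun, charFun_apply_real]
  refine (integral_congr_ae (ae_of_all _ fun x => ?_)).trans h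
  simp only [← ofReal_mul]
  exact (exp_ofReal_mul_I_re _).symm

lemma integral_sin_eq_zero_of_isSymmetricLaw (hμ : IsSymmetricLaw μ) (t : ℝ) :
    ∫ x, Real.sin (t * x) ∂μ = 0 := by
  have h : ∫ x, Real.sin (t * x) ∂μ = ∫ x, Real.sin (t * -x) ∂μ := by
    conv_lhs => rw [← hμ]
    rw [integral_map (by fun_prop) (by fun_prop)]
  simp only [mul_neg, Real.sin_neg, integral_neg] at h
  linarith

lemma integral_sin_sq_eq [IsProbabilityMeasure μ] (t : ℝ) :
    ∫ x, Real.sin (t * x) ^ 2 ∂μ = (1 - realCharFun μ (2 * t)) / 2 := by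
  have h (x : ℝ) : Real.sin (t * x) ^ 2 = (1 - Real.cos (2 * t * x)) / 2 := by
    rw [mul_assoc, Real.cos_two_mul, Real.cos_sq']
    ring
  simp_rw [h]
  rw [integral_div, integral_sub (by simp), integral_cos_eq_realCharFun]
  · simp
  · exact Integrable.of_bound (by fun_prop) 1 (ae_of_all _ fun x => Real.abs_cos_le_one _)

end SymmetricLaw

/-- The delta method for the inverse tangent of a ratio `B / A` with `B = T / √L`. -/
lemma tendstoInDistribution_sqrt_mul_arctan {Ω : Type*} [MeasurableSpace Ω] {P : Measure Ω}
    [IsProbabilityMeasure P] {X T A : ℕ → Ω → ℝ} {a ω s : ℝ} (ha : a ≠ 0)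
    (hX : ∀ n, AEMeasurable (X n) P) (hA : ∀ n, AEMeasurable (A n) P)
    (hT : TendstoInDistribution T atTop (id : ℝ → ℝ) (fun _ => P) (gaussianReal 0 s.toNNReal))
    (hTlim : ∀ᵐ w ∂P, Tendsto (fun n : ℕ => T n w / √n) atTop (𝓝 0))
    (hAlim : ∀ᵐ w ∂P, Tendsto (fun n => A n w) atTop (𝓝 a))
    (hXT : ∀ᵐ w ∂P, ∀ᶠ n : ℕ in atTop, X n w = √n * (1 / ω * Real.arctan (T n w / √n / A n w))) :
    TendstoInDistribution X atTop (id : ℝ → ℝ) (fun _ => P)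
      (gaussianReal 0 (s / (ω * a) ^ 2).toNNReal) := by
  -- `dslope Real.arctan 0` is `arctan x / x`, continued by `1` at `0`. It turns `X n` into `T n * R
  -- n` with `R n` tending a.s. to a constant, so Slutsky's theorem applies.
  have hcont : Continuous (dslope Real.arctan 0) :=
    continuous_iff_continuousAt.2 fun x => by
      rcases eq_or_ne x 0 with rfl | hx
      · exact continuousAt_dslope_same.2 (Real.differentiableAt_arctan 0)
      · exact (continuousAt_dslope_of_ne hx).2 Real.continuous_arctan.continuousAt
  have hone : dslope Real.arctan 0 0 = 1 := by simp [dslope_same]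
  have harctan (x : ℝ) : Real.arctan x = x * dslope Real.arctan 0 x := by
    simpa using (sub_smul_dslope Real.arctan 0 x).symm
  have hTm := hT.forall_aemeasurable
  set R : ℕ → Ω → ℝ := fun n w => dslope Real.arctan 0 (T n w / √n / A n w) / (ω * A n w) with hR
  have hRm (n : ℕ) : AEMeasurable (R n) P :=
    (hcont.measurable.comp_aemeasurable (((hTm n).div_const _).div (hA n))).div
      ((hA n).const_mul ω)
  have hRlim : ∀ᵐ w ∂P, Tendsto (fun n => R n w) atTop (𝓝 (1 / (ω * a))) := by
    -- For `ω = 0`, division by zero makes both `R` and its limit `0`.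
    by_cases hω : ω = 0
    · simp [hR, hω]
    filter_upwards [hTlim, hAlim] with w h1 h2
    have h3 := (hcont.tendsto 0).comp (by simpa using h1.div h2 ha)
    rw [hone] at h3
    exact h3.div (h2.const_mul ω) (mul_ne_zero hω ha)
  have hY := hT.continuous_comp_prodMk_of_tendstoInMeasure_const (g := fun p : ℝ × ℝ => p.1 * p.2)
    (by fun_prop) (tendstoInMeasure_of_tendsto_ae (fun n => (hRm n).aestronglyMeasurable) hRlim) hRm
  have hXY := tendstoInDistribution_of_tendstoInMeasure_sub X _ hY ?_ hX
  · refine ⟨hX, aemeasurable_id, ?_⟩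
    convert! hXY.tendsto using 2
    refine congrArg 𝓝 (Subtype.ext ?_)
    have hmap := gaussianReal_map_mul_const (μ := 0) (v := s.toNNReal) (1 / (ω * a))
    simp only [id] at hmap ⊢
    refine (Measure.map_id'.trans ?_).trans hmap.symm
    congr 1
    · simp
    · ext
      rcases le_total 0 s with h | h
      · simp [Real.coe_toNNReal _ h, Real.coe_toNNReal _ (div_nonneg h (sq_nonneg (ω * a)))]
        field_simp
      · simp [Real.toNNReal_of_nonpos h,
          Real.toNNReal_of_nonpos (div_nonpos_of_nonpos_of_nonneg h (sq_nonneg (ω * a)))]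
  · refine tendstoInMeasure_of_tendsto_ae
      (fun n => ((hX n).sub ((hTm n).mul (hRm n))).aestronglyMeasurable) ?_
    filter_upwards [hXT] with w hw
    refine tendsto_const_nhds.congr' ?_
    filter_upwards [hw, eventually_gt_atTop 0] with n hn hn0
    have : (√(n : ℝ)) ≠ 0 := by positivity
    simp only [Pi.sub_apply, Pi.zero_apply, hn, hR, harctan (T n w / √n / A n w)]
    field_simp
    simp

/-! ### Polar form and inverse tangents -/

section Phase

/-- The ratio `B / A` fixes the direction only modulo `π`, so `r` carries the sign of `A`. -/
lemma exists_polar_arctan {A B : ℝ} (hA : A ≠ 0) :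
    ∃ r : ℝ, r ≠ 0 ∧ (0 < A → 0 < r) ∧
      (A : ℂ) + B * I = r * cexp (Real.arctan (B / A) * I) := by
  have hc := Real.cos_arctan_pos (B / A)
  have hs : Real.sin (Real.arctan (B / A)) = B / A * Real.cos (Real.arctan (B / A)) := by
    rw [← Real.tan_mul_cos hc.ne', Real.tan_arctan]
  refine ⟨A / Real.cos (Real.arctan (B / A)), div_ne_zero hA hc.ne', fun h => div_pos h hc, ?_⟩
  rw [exp_mul_I, ← ofReal_cos, ← ofReal_sin, hs]
  generalize Real.cos (Real.arctan (B / A)) = c at hc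
  have hc' : (c : ℂ) ≠ 0 := by exact_mod_cast hc.ne'
  have hA' : (A : ℂ) ≠ 0 := by exact_mod_cast hA
  push_cast
  field_simp

lemma arctan_im_div_re_of_polar {r β : ℝ} (hr : r ≠ 0)
    (hβ : β ∈ Set.Ioo (-(Real.pi / 2)) (Real.pi / 2)) :
    Real.arctan ((r * cexp (β * I)).im / (r * cexp (β * I)).re) = β := by
  rw [re_ofReal_mul, im_ofReal_mul, exp_ofReal_mul_I_re, exp_ofReal_mul_I_im,
    mul_div_mul_left _ _ hr, ← Real.tan_eq_sin_div_cos, Real.arctan_tan hβ.1 hβ.2]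

lemma phase_of_polar {r β : ℝ} (hr : 0 < r) (hβ : β ∈ Set.Ico 0 (2 * Real.pi)) :
    phase (r * cexp (β * I)) = β := by
  rw [phase, exp_mul_I, arg_mul_cos_add_sin_mul_I_eq_toIocMod hr]
  -- `arg` differs from `β` by a multiple of `2π`, which the reduction to `[0, 2π)` removes.
  rw [show toIocMod Real.two_pi_pos (-Real.pi) β =
    β - toIocDiv Real.two_pi_pos (-Real.pi) β • (2 * Real.pi) from rfl, toIcoMod_sub_zsmul,
    toIcoMod_eq_self]
  simpa using hβ

lemma measurable_phase : Measurable phase := by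
  have h : phase = fun z => if arg z < 0 then arg z + 2 * Real.pi else arg z := by
    ext z
    have h1 := neg_pi_lt_arg z
    have h2 := arg_le_pi z
    have h3 := Real.pi_pos
    rw [phase]
    split_ifs with h
    · rw [← toIcoMod_add_right, toIcoMod_eq_self]
      constructor <;> linarith
    · rw [toIcoMod_eq_self]
      constructor <;> linarith
  rw [h]
  exact Measurable.ite (measurableSet_lt measurable_arg measurable_const)
    (measurable_arg.add_const _) measurable_arg

end Phase

lemma normalizedSignal_eq {Ω : Type*} {PT : ℝ} (hPT : 0 < PT) (ω θ : ℝ) (η : ℕ → Ω → ℝ) (v : Ω → ℂ)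
    {L : ℕ} (hL : 0 < L) (w : Ω) :
    normalizedSignal PT ω θ η v L w = √PT * cexp ((ω * θ : ℝ) * I) *
      (((L : ℝ)⁻¹ * ∑ i ∈ Finset.range L, Real.cos (ω * η i w) +
          (√L)⁻¹ * ((Real.cos (ω * θ) * (v w).re + Real.sin (ω * θ) * (v w).im) / √PT) : ℝ) +
        (((√L)⁻¹ * ∑ i ∈ Finset.range L, Real.sin (ω * η i w) +
          (-Real.sin (ω * θ) / √PT * (v w).re + Real.cos (ω * θ) / √PT * (v w).im)) / √L : ℝ) * I) := by
  have hP : (√PT : ℂ) ≠ 0 := by exact_mod_cast (Real.sqrt_pos.2 hPT).ne'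
  have hl : (√(L : ℝ) : ℂ) ≠ 0 := by
    exact_mod_cast (Real.sqrt_pos.2 (Nat.cast_pos.2 hL : (0 : ℝ) < L)).ne'
  have hL2 : ((L : ℝ) : ℂ) = (√(L : ℝ) : ℂ) ^ 2 := by
    rw [← ofReal_pow, Real.sq_sqrt (Nat.cast_nonneg L)]
  have hexp (i : ℕ) : cexp (I * ((ω * measurement θ η i w : ℝ) : ℂ)) =
      cexp ((ω * θ : ℝ) * I) * (Real.cos (ω * η i w) + Real.sin (ω * η i w) * I) := by
    rw [ofReal_cos, ofReal_sin, ← exp_mul_I, ← Complex.exp_add, measurement]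
    congr 1
    push_cast
    ring
  have hcs : (Real.cos (ω * θ) : ℂ) ^ 2 + (Real.sin (ω * θ) : ℂ) ^ 2 = 1 := by
    exact_mod_cast Real.cos_sq_add_sin_sq (ω * θ)
  rw [normalizedSignal, receivedSignal, Finset.sum_congr rfl fun i _ => hexp i, ← Finset.mul_sum,
    Finset.sum_add_distrib, ← Finset.sum_mul, Real.sqrt_div hPT.le]
  conv_lhs => rw [← re_add_im (v w)]
  rw [exp_mul_I, ← ofReal_cos, ← ofReal_sin]
  push_cast [-ofReal_cos, -ofReal_sin]
  rw [← ofReal_natCast, hL2]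
  generalize (∑ i ∈ Finset.range L, (Real.cos (ω * η i w) : ℂ)) = C
  generalize (∑ i ∈ Finset.range L, (Real.sin (ω * η i w) : ℂ)) = S
  field_simp
  linear_combination (-(√(L : ℝ) : ℂ) * ((v w).re + (v w).im * I)) * hcs +
    ((√(L : ℝ) : ℂ) * ((Real.sin (ω * θ) : ℂ) ^ 2 * (v w).re -
      Real.cos (ω * θ) * Real.sin (ω * θ) * (v w).im)) * Complex.I_sq

lemma aemeasurable_normalizedSignal {Ω : Type*} [MeasurableSpace Ω] {P : Measure Ω}
    {η : ℕ → Ω → ℝ} {v : Ω → ℂ} (hη : ∀ i, AEMeasurable (η i) P) (hv : AEMeasurable v P)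
    (PT ω θ : ℝ) (L : ℕ) : AEMeasurable (normalizedSignal PT ω θ η v L) P := by
  unfold normalizedSignal receivedSignal measurement
  refine AEMeasurable.div_const (AEMeasurable.add (AEMeasurable.const_mul
    (Finset.aemeasurable_fun_sum _ fun i _ => ?_) _) hv) _
  have := hη i
  fun_prop

/-- An estimator that returns `β / ω` on `r * exp (β * I)`, for `β` near `ω * θ` and `r` of the sign
of the limit, is asymptotically normal with variance `AsV`. -/
lemma asymptoticallyNormal_of_polar {Ω : Type*} [MeasurableSpace Ω] (P : Measure Ω)
    [IsProbabilityMeasure P] {η : ℕ → Ω → ℝ} {v : Ω → ℂ} {μ : Measure ℝ} {θ ω PT σv : ℝ}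
    (hω : ω ≠ 0) (hPT : 0 < PT)
    (hη_indep : iIndepFun η P) (hη_law : ∀ i, HasLaw (η i) μ P) (hμ : IsSymmetricLaw μ)
    (hv_law : HasLaw v (complexGaussian (σv ^ 2)) P)
    (hv_indep : IndepFun (fun w i => η i w) v P)
    (hφ : realCharFun μ ω ≠ 0) {est : ℂ → ℝ} (hest : Measurable est)
    (hpolar : ∀ᶠ β : ℝ in 𝓝 (ω * θ), ∀ r : ℝ, r ≠ 0 → (0 < realCharFun μ ω → 0 < r) →
      est (r * cexp (β * I)) = 1 / ω * β) :
    AsymptoticallyNormal P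
      (fun L w => Real.sqrt L * (est (normalizedSignal PT ω θ η v L w) - θ)) 0
      (AsV μ PT σv ω) := by
  have : IsProbabilityMeasure μ := (hη_law 0).isProbabilityMeasure_iff.1 inferInstance
  have hηm (i : ℕ) : AEMeasurable (η i) P := (hη_law i).aemeasurable
  have hident (i : ℕ) : IdentDistrib (η i) (η 0) P P :=
    ⟨hηm i, hηm 0, (hη_law i).map_eq.trans (hη_law 0).map_eq.symm⟩
  have hlt : 0 ≤ (1 - realCharFun μ (2 * ω)) / 2 := by
    rw [← integral_sin_sq_eq]
    exact integral_nonneg fun x => sq_nonneg _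
  have hσ : 0 ≤ σv ^ 2 / PT / 2 := by positivity
  have hAsV : AsV μ PT σv ω =
      ((1 - realCharFun μ (2 * ω)) / 2 + σv ^ 2 / PT / 2) / (ω * realCharFun μ ω) ^ 2 := by
    rw [AsV]
    field_simp
    ring
  rw [hAsV]
  refine ⟨by positivity, ?_⟩
  -- the quadrature components of the sensing noise
  have hsin_indep : iIndepFun (fun i w => Real.sin (ω * η i w)) P :=
    hη_indep.comp (fun _ x => Real.sin (ω * x)) fun _ => by fun_prop
  have hcos_indep : iIndepFun (fun i w => Real.cos (ω * η i w)) P :=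
    hη_indep.comp (fun _ x => Real.cos (ω * x)) fun _ => by fun_prop
  have hsin_ident (i : ℕ) := (hident i).comp (u := fun x => Real.sin (ω * x)) (by fun_prop)
  have hcos_ident (i : ℕ) := (hident i).comp (u := fun x => Real.cos (ω * x)) (by fun_prop)
  have hm0 := hηm 0
  have hsin_memLp : MemLp (fun w => Real.sin (ω * η 0 w)) 2 P :=
    MemLp.of_bound (by fun_prop) 1 (ae_of_all _ fun w => Real.abs_sin_le_one _)
  have hcos_int : Integrable (fun w => Real.cos (ω * η 0 w)) P :=
    Integrable.of_bound (by fun_prop) 1 (ae_of_all _ fun w => Real.abs_cos_le_one _)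
  have hsin_mean : ∫ w, Real.sin (ω * η 0 w) ∂P = 0 :=
    ((hη_law 0).integral_comp (f := fun x => Real.sin (ω * x)) (by fun_prop)).trans
      (integral_sin_eq_zero_of_isSymmetricLaw hμ ω)
  have hcos_mean : ∫ w, Real.cos (ω * η 0 w) ∂P = realCharFun μ ω :=
    ((hη_law 0).integral_comp (f := fun x => Real.cos (ω * x)) (by fun_prop)).trans
      (integral_cos_eq_realCharFun ω)
  have hsin_var : Var[fun w => Real.sin (ω * η 0 w); P] = (1 - realCharFun μ (2 * ω)) / 2 := by
    rw [variance_of_integral_eq_zero (by fun_prop) hsin_mean, ← integral_sin_sq_eq]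
    exact (hη_law 0).integral_comp (f := fun x => Real.sin (ω * x) ^ 2) (by fun_prop)
  have hclt := tendstoInDistribution_inv_sqrt_mul_sum_sub (X := fun i w => Real.sin (ω * η i w))
    (Y := id) (P' := gaussianReal 0 Var[fun w => Real.sin (ω * η 0 w); P].toNNReal)
    HasLaw.id hsin_memLp hsin_indep hsin_ident
  simp only [hsin_mean, hsin_var, mul_zero, sub_zero] at hclt
  have hsin_lln := strong_law_ae_real (fun i w => Real.sin (ω * η i w))
    (hsin_memLp.integrable (by norm_num)) (fun i j hij => hsin_indep.indepFun hij) hsin_ident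
  have hcos_lln := strong_law_ae_real (fun i w => Real.cos (ω * η i w)) hcos_int
    (fun i j hij => hcos_indep.indepFun hij) hcos_ident
  rw [hsin_mean] at hsin_lln
  rw [hcos_mean] at hcos_lln
  -- the quadrature component of the channel noise
  set W : ℂ → ℝ := fun z =>
    -Real.sin (ω * θ) / √PT * z.re + Real.cos (ω * θ) / √PT * z.im with hW
  have hW_law : HasLaw (fun w => W (v w)) (gaussianReal 0 (σv ^ 2 / PT / 2).toNNReal) P := by
    refine ⟨by have := hv_law.aemeasurable; fun_prop, ?_⟩
    rw [← Function.comp_def W v, ← AEMeasurable.map_map_of_aemeasurable (by fun_prop)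
      hv_law.aemeasurable, hv_law.map_eq, complexGaussian_map_re_im]
    congr 2
    -- Rotating the noise by `-ωθ` leaves its variance unchanged.
    rw [div_pow, div_pow, Real.sq_sqrt hPT.le, neg_sq, ← add_div, Real.sin_sq_add_cos_sq]
    ring
  have hT := tendstoInDistribution_add_gaussian hclt hW_law fun n =>
    hv_indep.comp (φ := fun x : ℕ → ℝ => (√(n : ℝ))⁻¹ * ∑ k ∈ Finset.range n, Real.sin (ω * x k))
      (ψ := W) (by fun_prop) (by fun_prop)
  rw [← Real.toNNReal_add hlt hσ] at hT
  have hsqrt : Tendsto (fun n : ℕ => (√(n : ℝ))⁻¹) atTop (𝓝 0) :=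
    tendsto_inv_atTop_zero.comp (Real.tendsto_sqrt_atTop.comp tendsto_natCast_atTop_atTop)
  have hTlim : ∀ᵐ w ∂P, Tendsto (fun n : ℕ => ((√(n : ℝ))⁻¹ *
      ∑ k ∈ Finset.range n, Real.sin (ω * η k w) + W (v w)) / √n) atTop (𝓝 0) := by
    filter_upwards [hsin_lln] with w hw
    have h := hw.add (hsqrt.mul_const (W (v w)))
    rw [zero_mul, add_zero] at h
    refine h.congr fun n => ?_
    nth_rw 1 [← Real.mul_self_sqrt (Nat.cast_nonneg (α := ℝ) n)]
    ring
  have hAlim : ∀ᵐ w ∂P, Tendsto (fun n : ℕ => (n : ℝ)⁻¹ *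
      ∑ k ∈ Finset.range n, Real.cos (ω * η k w) + (√(n : ℝ))⁻¹ *
        ((Real.cos (ω * θ) * (v w).re + Real.sin (ω * θ) * (v w).im) / √PT)) atTop
      (𝓝 (realCharFun μ ω)) := by
    filter_upwards [hcos_lln] with w hw
    have h := hw.add (hsqrt.mul_const
      ((Real.cos (ω * θ) * (v w).re + Real.sin (ω * θ) * (v w).im) / √PT))
    rw [zero_mul, add_zero] at h
    exact h.congr fun n => by rw [div_eq_inv_mul]
  refine tendstoInDistribution_sqrt_mul_arctan hφ (fun n => ?_) (fun n => ?_) hT hTlim hAlim ?_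
  · exact ((hest.comp_aemeasurable (aemeasurable_normalizedSignal hηm hv_law.aemeasurable
      PT ω θ n)).sub_const θ).const_mul _
  · have := hv_law.aemeasurable
    fun_prop
  · filter_upwards [hTlim, hAlim] with w h1 h2
    have h3 := ((Real.continuous_arctan.tendsto 0).comp
      (by simpa using h1.div h2 hφ)).const_add (ω * θ)
    rw [Real.arctan_zero, add_zero] at h3
    -- The quadrant-aware phase needs a positive radius; the principal arctangent is blind to its
    -- sign.
    have hpos : ∀ᶠ n : ℕ in atTop, 0 < realCharFun μ ω → 0 < (n : ℝ)⁻¹ *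
        ∑ k ∈ Finset.range n, Real.cos (ω * η k w) + (√(n : ℝ))⁻¹ *
        ((Real.cos (ω * θ) * (v w).re + Real.sin (ω * θ) * (v w).im) / √PT) := by
      by_cases h : 0 < realCharFun μ ω
      · filter_upwards [h2.eventually_const_lt h] with n hn _ using hn
      · exact Eventually.of_forall fun n h' => absurd h' h
    filter_upwards [h3.eventually hpolar, h2.eventually_ne hφ, hpos, eventually_gt_atTop 0]
      with n hn hne hpos hn0
    rw [normalizedSignal_eq hPT ω θ η v hn0 w]
    obtain ⟨r, hr, hr0, heq⟩ := exists_polar_arctan (B := ((√(n : ℝ))⁻¹ *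
      ∑ k ∈ Finset.range n, Real.sin (ω * η k w) + W (v w)) / √n) hne
    have hP := Real.sqrt_pos.2 hPT
    rw [heq, mul_mul_mul_comm, ← Complex.exp_add, ← add_mul, ← ofReal_mul, ← ofReal_add]
    have hn' := hn (√PT * r) (mul_ne_zero hP.ne' hr) fun h => mul_pos hP (hr0 (hpos h))
    have hsub (x : ℝ) : 1 / ω * (ω * θ + x) - θ = 1 / ω * x := by
      field_simp
      ring
    exact congrArg (√(n : ℝ) * ·) ((congrArg (· - θ) hn').trans (hsub _))

theorem theorem4 {Ω : Type*} [MeasurableSpace Ω] (P : Measure Ω) [IsProbabilityMeasure P]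
    (η : ℕ → Ω → ℝ) (v : Ω → ℂ) (μ : Measure ℝ)
    (θR θ ω PT σv : ℝ)
    -- parameter range, design parameter, total power, noise level
    (hθR : 0 < θR) (hθ : θ ∈ Set.Icc 0 θR) (hω : ω ∈ Set.Ioc 0 (2 * Real.pi / θR))
    (hPT : 0 < PT) (hσv : 0 ≤ σv)
    -- i.i.d. sensing noise with an arbitrary symmetric common law
    (hη_indep : iIndepFun η P) (hη_law : ∀ i, HasLaw (η i) μ P) (hμ : IsSymmetricLaw μ)
    -- complex Gaussian channel noise, independent of the sensing noise
    (hv_law : HasLaw v (complexGaussian (σv ^ 2)) P)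
    (hv_indep : IndepFun (fun w i => η i w) v P) :
    (realCharFun μ ω ≠ 0 → ω * θ < Real.pi / 2 →
      AsymptoticallyNormal P
        (fun L w => Real.sqrt L * (arctanEstimate ω (normalizedSignal PT ω θ η v L w) - θ))
        0 (AsV μ PT σv ω)) ∧
    (0 < realCharFun μ ω → 0 < ω * θ → ω * θ < 2 * Real.pi →
      AsymptoticallyNormal P
        (fun L w => Real.sqrt L * (phaseEstimate ω (normalizedSignal PT ω θ η v L w) - θ))
        0 (AsV μ PT σv ω)) := by
  refine ⟨fun hφ hlt => ?_, fun hφ h0 hlt => ?_⟩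
  · refine asymptoticallyNormal_of_polar P hω.1.ne' hPT hη_indep hη_law hμ hv_law hv_indep hφ
      (by unfold arctanEstimate; fun_prop) ?_
    have h0 : -(Real.pi / 2) < ω * θ := by
      have := mul_nonneg hω.1.le hθ.1
      have := Real.pi_pos
      linarith
    filter_upwards [Ioo_mem_nhds h0 hlt] with β hβ r hr _
    rw [arctanEstimate, arctan_im_div_re_of_polar hr hβ]
  · refine asymptoticallyNormal_of_polar P hω.1.ne' hPT hη_indep hη_law hμ hv_law hv_indep hφ.ne'
      (measurable_phase.const_mul _) ?_
    filter_upwards [Ioo_mem_nhds h0 hlt] with β hβ r _ hr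
    rw [phaseEstimate, phase_of_polar (hr hφ) ⟨hβ.1.le, hβ.2⟩]
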